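/- Let $\mathbb{A}$ be a countably infinite set, whose elements are called atoms. A \emph{set with atoms} is a set $X$ with an action of the group of all permutations of $\mathbb{A}$ such that every $x \in X$ has a finite support, i.e. there is a finite $\alpha \subseteq \mathbb{A}$ such that $\pi(x) = x$ for every permutation $\pi$ of $\mathbb{A}$ that fixes every element of $\alpha$. It is \emph{orbit-finite} if it has finitely many orbits under this action. A \emph{deterministic orbit-finite automaton} over an orbit-finite alphabet $\Sigma$ consists of an orbit-finite set $Q$ of states, an initial state $q_0 \in Q$ with $\pi(q_0) = q_0$ for all $\pi$, a set $Q_{\mathrm{acc}} \subseteq Q$ of accepting states that is invariant under all $\pi$, and a transition function $f : Q \times \Sigma \to Q$ with $f(\pi(q), \pi(a)) = \pi(f(q,a))$ for all $\pi, q, a$. It accepts a word if the run from $q_0$ on this word ends in $Q_{\mathrm{acc}}$. A \emph{deterministic register automaton} over the alphabet $\mathbb{A}$ consists of a finite set $Q$ of control states, a finite set $R$ of registers, an initial control state, a set of accepting control states, and a transition function $$\delta : \bigl(Q \times (\mathbb{A} \cup \{\bot\})^R\bigr) \times \mathbb{A} \to Q \times (\mathbb{A} \cup \{\bot\})^R$$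 that is equivariant. Initially all registers are empty (hold $\bot$), and a word is accepted if the control state after reading it is accepting. Equivariance of $\delta$ may be understood in either of two senses. (1) Semantic: $\delta(\pi(c), \pi(a)) = \pi(\delta(c,a))$ for all permutations $\pi$ of $\mathbb{A}$, all configurations $c$ and all atoms $a$, where $\pi$ acts on the register values and fixes control states and $\bot$. (2) Syntactic: $\delta$ is given by a finite list of commands of the form (list of conditions $\to$ list of actions). The first command whose conditions all hold is selected and its actions are performed in order (if there is none, the configuration is unchanged). The conditions are $r = s$, $r = \mathtt{input}$, $r = \bot$, $\mathtt{state} = q$ and their negations, and the actions are $r := \mathtt{input}$, $r := s$, $\mathrm{swap}(r,s)$, $r := \bot$, $\mathtt{state} := q$, for registers $r, s$ and control states $q$. \textbf{Theorem.} Deterministic register automata and deterministic orbit-finite automata recognise the same languages over the alphabet $\mathbb{A}$: with either sense of equivariance, a language $L \subseteq \mathbb{A}^*$ is recognised by a deterministic register automaton if and only if it is recognised by a deterministic orbit-finite automaton with alphabet $\mathbb{A}$. -/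

import Mathlib

universe u v

/-! ## Sets with atoms

The atoms are the elements of a type `𝔸` (countably infinite in the theorem); atom permutations are
the elements of `Equiv.Perm 𝔸`, acting on `𝔸` by evaluation. -/

section Atoms

variable (𝔸 : Type u) (X : Type v) [MulAction (Equiv.Perm 𝔸) X]

/-- `X`, with its action of the atom permutations, is a set with atoms: every element is supported
by some finite set of atoms. -/
def IsSetWithAtoms : Prop :=
  ∀ x : X, ∃ s : Set 𝔸, s.Finite ∧ MulAction.Supports (Equiv.Perm 𝔸) s x

/-- `X` is an orbit-finite set: a set with atoms that has only finitely many orbits. -/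
structure IsOrbitFiniteSet : Prop where
  isSetWithAtoms : IsSetWithAtoms 𝔸 X
  finite_orbits : Finite (MulAction.orbitRel.Quotient (Equiv.Perm 𝔸) X)

end Atoms

/-! ## Deterministic orbit-finite automata -/

/-- A deterministic orbit-finite automaton with alphabet `S` and set of states `Q`. Runs and the
recognised language `toDFA.accepts` are those of the underlying (infinite) deterministic
automaton. -/
structure OrbitFiniteAutomaton (𝔸 : Type*) (S : Type*) (Q : Type*)
    [MulAction (Equiv.Perm 𝔸) S] [MulAction (Equiv.Perm 𝔸) Q] extends DFA S Q where
  alphabet_orbitFinite : IsOrbitFiniteSet 𝔸 S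
  states_orbitFinite : IsOrbitFiniteSet 𝔸 Q
  start_equivariant : ∀ π : Equiv.Perm 𝔸, π • start = start
  accept_equivariant : ∀ (π : Equiv.Perm 𝔸) (q : Q), π • q ∈ accept ↔ q ∈ accept
  step_equivariant : ∀ (π : Equiv.Perm 𝔸) (q : Q) (a : S), step (π • q) (π • a) = π • step q a

/-- The language `L` over the alphabet `𝔸` is recognised by a deterministic orbit-finite
automaton (whose set of states may live in any universe). -/
def IsOrbitFiniteRecognizable {𝔸 : Type u} (L : Language 𝔸) : Prop :=
  ∃ (Q : Type v) (_ : MulAction (Equiv.Perm 𝔸) Q) (A : OrbitFiniteAutomaton 𝔸 𝔸 Q),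
    A.toDFA.accepts = L

/-! ## Deterministic register automata -/

/-- Memory configurations: a control state, and for each register either an atom or `none`
(an empty register). -/
abbrev RegConfig (𝔸 Q R : Type*) : Type _ := Q × (R → Option 𝔸)

/-- An atom permutation is applied to every register value; the control state and the empty
registers stay unchanged. -/
def RegConfig.perm {𝔸 Q R : Type*} (π : Equiv.Perm 𝔸) (c : RegConfig 𝔸 Q R) : RegConfig 𝔸 Q R :=
  (c.1, fun r => (c.2 r).map π)

/-- Semantic equivariance: the transition function commutes with all atom permutations. -/
def IsSemanticallyEquivariant {𝔸 Q R : Type*} (δ : RegConfig 𝔸 Q R → 𝔸 → RegConfig 𝔸 Q R) : Prop :=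
  ∀ (π : Equiv.Perm 𝔸) (c : RegConfig 𝔸 Q R) (a : 𝔸), δ (c.perm π) (π a) = (δ c a).perm π

/-- The positive tests: `r = s`, `r = input`, `r = ⊥`, `state = q`. -/
inductive RegTest (Q R : Type*)
  | eqReg (r s : R)
  | eqInput (r : R)
  | isEmpty (r : R)
  | inState (q : Q)

def RegTest.Holds {𝔸 Q R : Type*} (c : RegConfig 𝔸 Q R) (a : 𝔸) : RegTest Q R → Prop
  | .eqReg r s => c.2 r = c.2 s
  | .eqInput r => c.2 r = some a
  | .isEmpty r => c.2 r = none
  | .inState q => c.1 = q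

/-- A condition is a test or the negation of a test. -/
inductive RegCondition (Q R : Type*)
  | pos (t : RegTest Q R)
  | neg (t : RegTest Q R)

def RegCondition.Holds {𝔸 Q R : Type*} (c : RegConfig 𝔸 Q R) (a : 𝔸) : RegCondition Q R → Prop
  | .pos t => t.Holds c a
  | .neg t => ¬ t.Holds c a

/-- The actions: `r := input`, `r := s`, `swap (r, s)`, `r := ⊥`, `state := q`. -/
inductive RegAction (Q R : Type*)
  | load (r : R)
  | copy (r s : R)
  | swap (r s : R)
  | clear (r : R)
  | setState (q : Q)

open Classical in
/-- The effect of one action on a configuration, when the current input letter is `a`. -/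
noncomputable def RegAction.apply {𝔸 Q R : Type*} (a : 𝔸) (c : RegConfig 𝔸 Q R) :
    RegAction Q R → RegConfig 𝔸 Q R
  | .load r => (c.1, Function.update c.2 r (some a))
  | .copy r s => (c.1, Function.update c.2 r (c.2 s))
  | .swap r s => (c.1, c.2 ∘ Equiv.swap r s)
  | .clear r => (c.1, Function.update c.2 r none)
  | .setState q => (q, c.2)

/-- A conditional command: a list of conditions and a list of actions. -/
structure RegCommand (Q R : Type*) where
  conditions : List (RegCondition Q R)
  actions : List (RegAction Q R)

open Classical in
/-- The first command all of whose conditions hold is selected, and its actions are performed one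
after another; if there is no such command, the configuration does not change. -/
noncomputable def RegCommand.run {𝔸 Q R : Type*} :
    List (RegCommand Q R) → RegConfig 𝔸 Q R → 𝔸 → RegConfig 𝔸 Q R
  | [], c, _ => c
  | k :: P, c, a =>
      if ∀ b ∈ k.conditions, b.Holds c a then k.actions.foldl (RegAction.apply a) c
      else RegCommand.run P c a

/-- Syntactic equivariance: the transition function is specified by a finite list of conditional
commands. -/
def IsSyntacticallyEquivariant {𝔸 Q R : Type*}
    (δ : RegConfig 𝔸 Q R → 𝔸 → RegConfig 𝔸 Q R) : Prop :=
  ∃ P : List (RegCommand Q R), δ = RegCommand.run P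

/-- The data of a deterministic register automaton with control states `Q` and registers `R`; the
restriction on the transition function is imposed separately. -/
structure RegisterAutomaton (𝔸 Q R : Type*) where
  start : Q
  accept : Set Q
  step : RegConfig 𝔸 Q R → 𝔸 → RegConfig 𝔸 Q R

/-- The automaton on memory configurations: all registers are empty at the start, and acceptance
depends only on the control state. -/
def RegisterAutomaton.toDFA {𝔸 Q R : Type*} (A : RegisterAutomaton 𝔸 Q R) :
    DFA 𝔸 (RegConfig 𝔸 Q R) where
  step := A.step
  start := (A.start, fun _ => none)
  accept := {c | c.1 ∈ A.accept}

/-- `L` is recognised by a deterministic register automaton (finitely many control states and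
registers) whose transition function is semantically equivariant. -/
def IsRegisterRecognizable {𝔸 : Type u} (L : Language 𝔸) : Prop :=
  ∃ (Q R : Type) (_ : Finite Q) (_ : Finite R) (A : RegisterAutomaton 𝔸 Q R),
    IsSemanticallyEquivariant A.step ∧ A.toDFA.accepts = L

/-- `L` is recognised by a deterministic register automaton (finitely many control states and
registers) whose transition function is given by a list of conditional commands. -/
def IsRegisterProgramRecognizable {𝔸 : Type u} (L : Language 𝔸) : Prop :=
  ∃ (Q R : Type) (_ : Finite Q) (_ : Finite R) (A : RegisterAutomaton 𝔸 Q R),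
    IsSyntacticallyEquivariant A.step ∧ A.toDFA.accepts = L

/-! A configuration is a control state with finitely many optional atoms, so up to permutation it is
determined by the state and by which registers are equal or empty. Configurations therefore form an
orbit-finite set, and a semantically equivariant register automaton is already an orbit-finite
automaton. Programs are semantically equivariant because tests and actions commute with
permutations.

Conversely, choose representatives `x i` of the finitely many orbits and a finite tuple `e` of atoms
supporting all of them. A state `g • x i` is stored as the control state `i` together with
`g`-images of entries of `e`. The difficulty is that the next state must be written using only
stored atoms and the input. By equivariance these atoms support it, but the tuple `g ∘ e` may
contain others. Since finite supports are closed under intersection (`supports_inter`), the other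
entries can be left empty without losing the state. The required moves depend only on the satisfied
tests (`exists_actions_simulate`), of which there are finitely many sets, so one program performs
them all (`exists_program`). -/

/-! ## Extending finite partial injections to permutations -/

/-- A map that is injective on a finite set agrees there with some permutation. -/
theorem exists_perm_eqOn {α : Type*} {s : Set α} (hs : s.Finite) {f : α → α}
    (hf : Set.InjOn f s) : ∃ π : Equiv.Perm α, ∀ x ∈ s, π x = f x := by
  have := hs.to_subtype
  obtain ⟨n, ⟨e⟩⟩ := Finite.exists_equiv_fin s
  have hpre := Equiv.Perm.isMultiplyPretransitive α n
  let x : Fin n ↪ α := e.symm.toEmbedding.trans (Function.Embedding.subtype _)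
  let y : Fin n ↪ α := ⟨fun i => f (e.symm i), fun i j h =>
    e.symm.injective (Subtype.ext (hf (e.symm i).2 (e.symm j).2 h))⟩
  obtain ⟨π, hπ⟩ := hpre.exists_smul_eq x y
  refine ⟨π, fun a ha => ?_⟩
  have h := DFunLike.congr_fun hπ (e ⟨a, ha⟩)
  change π (e.symm (e ⟨a, ha⟩)) = f (e.symm (e ⟨a, ha⟩)) at h
  rwa [e.symm_apply_apply] at h

/-- Two finite families of optional elements with the same pattern of equalities and of empty
entries differ by a permutation. -/
theorem exists_perm_map_eq {α ι : Type*} [Finite ι] (v w : ι → Option α)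
    (heq : ∀ i j, v i = v j ↔ w i = w j) (hnone : ∀ i, v i = none ↔ w i = none) :
    ∃ π : Equiv.Perm α, ∀ i, (v i).map π = w i := by
  classical
  have hex : ∀ a : α, ∃ b : α, ∀ i, v i = some a → w i = some b := by
    intro a
    by_cases h : ∃ i, v i = some a
    · obtain ⟨i, hi⟩ := h
      obtain ⟨b, hb⟩ := Option.ne_none_iff_exists'.1
        (fun h0 => by simp [(hnone i).2 h0] at hi : w i ≠ none)
      exact ⟨b, fun j hj => by rw [← hb]; exact (heq j i).1 (hj.trans hi.symm)⟩
    · exact ⟨a, fun i hi => (h ⟨i, hi⟩).elim⟩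
  choose f hf using hex
  have hfin : {a | ∃ i, v i = some a}.Finite := by
    refine ((Set.finite_range v).preimage (Option.some_injective α).injOn).subset ?_
    rintro a ⟨i, hi⟩
    exact ⟨i, hi⟩
  have hinj : Set.InjOn f {a | ∃ i, v i = some a} := by
    rintro a ⟨i, hi⟩ b ⟨j, hj⟩ hab
    have h : v i = v j := (heq i j).2 (by rw [hf a i hi, hf b j hj, hab])
    exact Option.some_injective _ (by rw [← hi, ← hj, h])
  obtain ⟨π, hπ⟩ := exists_perm_eqOn hfin hinj
  refine ⟨π, fun i => ?_⟩
  cases hi : v i with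
  | none => exact ((hnone i).1 hi).symm
  | some a => rw [Option.map_some, hπ a ⟨i, hi⟩, hf a i hi]

/-! ## Supports -/

section Supports

variable {𝔸 : Type*} {X : Type*} [MulAction (Equiv.Perm 𝔸) X]

theorem smul_eq_smul_of_supports {s : Set 𝔸} {x : X}
    (hs : MulAction.Supports (Equiv.Perm 𝔸) s x) {g h : Equiv.Perm 𝔸}
    (hgh : ∀ a ∈ s, g a = h a) : g • x = h • x := by
  have h1 : (h⁻¹ * g) • x = x := hs _ fun a ha => by
    simp [Equiv.Perm.smul_def, Equiv.Perm.mul_apply, hgh a ha]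
  rw [mul_smul, inv_smul_eq_iff] at h1
  exact h1

theorem supports_smul {s : Set 𝔸} {x : X} (hs : MulAction.Supports (Equiv.Perm 𝔸) s x)
    (g : Equiv.Perm 𝔸) : MulAction.Supports (Equiv.Perm 𝔸) (g '' s) (g • x) := by
  intro h hh
  rw [← mul_smul]
  exact smul_eq_smul_of_supports hs fun a ha => hh (Set.mem_image_of_mem g ha)

/-- For infinitely many atoms, the intersection of two finite supports is a support. -/
theorem supports_inter [Infinite 𝔸] {s t : Set 𝔸} {x : X} (hs : s.Finite) (ht : t.Finite)
    (hsx : MulAction.Supports (Equiv.Perm 𝔸) s x) (htx : MulAction.Supports (Equiv.Perm 𝔸) t x) :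
    MulAction.Supports (Equiv.Perm 𝔸) (s ∩ t) x := by
  classical
  intro π hπ
  have hπ' : ∀ a, a ∈ s → a ∈ t → π a = a := fun a h1 h2 => hπ ⟨h1, h2⟩
  -- Move `t \ s` away from `s` and `π '' s`, fixing `s`.
  have hinf : ((s ∪ π '' s)ᶜ : Set 𝔸).Infinite := (hs.union (hs.image π)).infinite_compl
  have := hinf.to_subtype
  have := ht.to_subtype
  obtain ⟨φ⟩ : Nonempty (t ↪ ((s ∪ π '' s)ᶜ : Set 𝔸)) := by
    obtain ⟨n, ⟨e⟩⟩ := Finite.exists_equiv_fin t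
    exact ⟨e.toEmbedding.trans (Fin.valEmbedding.trans (Infinite.natEmbedding _))⟩
  have hφs : ∀ a, (φ a : 𝔸) ∉ s := fun a h => (φ a).2 (Or.inl h)
  have hφπ : ∀ a b, b ∈ s → (φ a : 𝔸) ≠ π b := fun a b hb h => (φ a).2 (Or.inr ⟨b, hb, h.symm⟩)
  let f : 𝔸 → 𝔸 := fun a => if a ∈ s then a else if h : a ∈ t then φ ⟨a, h⟩ else a
  have hfs : ∀ a ∈ s, f a = a := fun a ha => if_pos ha
  have hft : ∀ a, a ∉ s → ∀ h : a ∈ t, f a = φ ⟨a, h⟩ := fun a ha h => by simp [f, ha, h]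
  obtain ⟨τ, hτ⟩ : ∃ τ : Equiv.Perm 𝔸, ∀ a ∈ s ∪ t, τ a = f a := by
    refine exists_perm_eqOn (hs.union ht) fun a ha b hb hab => ?_
    by_cases has : a ∈ s <;> by_cases hbs : b ∈ s
    · rwa [hfs a has, hfs b hbs] at hab
    · rw [hfs a has, hft b hbs (hb.resolve_left hbs)] at hab
      exact (hφs _ (hab ▸ has)).elim
    · rw [hfs b hbs, hft a has (ha.resolve_left has)] at hab
      exact (hφs _ (hab ▸ hbs)).elim
    · rw [hft a has (ha.resolve_left has), hft b hbs (hb.resolve_left hbs)] at hab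
      simpa using φ.injective (Subtype.ext hab)
  have hτx : τ • x = x := hsx τ fun a ha => by
    rw [Equiv.Perm.smul_def, hτ a (Or.inl ha), hfs a ha]
  have htx' := supports_smul htx τ
  rw [hτx] at htx'
  -- Find `σ` that agrees with `π` on `s` and is the identity on the moved set.
  let k : 𝔸 → 𝔸 := fun a => if a ∈ s then π a else a
  have hks : ∀ a ∈ s, k a = π a := fun a ha => if_pos ha
  have hkc : ∀ a, a ∉ s → k a = a := fun a ha => if_neg ha
  have hout : ∀ b ∈ τ '' t, b ∉ s → ∀ a ∈ s, b ≠ π a := by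
    rintro _ ⟨b, hb, rfl⟩ hbs a ha
    rw [hτ b (Or.inr hb)] at hbs ⊢
    have hb' : b ∉ s := fun h => hbs (by rwa [hfs b h])
    rw [hft b hb' hb]
    exact hφπ _ a ha
  obtain ⟨σ, hσ⟩ : ∃ σ : Equiv.Perm 𝔸, ∀ a ∈ s ∪ τ '' t, σ a = k a := by
    refine exists_perm_eqOn (hs.union (ht.image τ)) fun a ha b hb hab => ?_
    by_cases has : a ∈ s <;> by_cases hbs : b ∈ s
    · rw [hks a has, hks b hbs] at hab
      exact π.injective hab
    · rw [hks a has, hkc b hbs] at hab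
      exact (hout b (hb.resolve_left hbs) hbs a has hab.symm).elim
    · rw [hkc a has, hks b hbs] at hab
      exact (hout a (ha.resolve_left has) has b hbs hab).elim
    · rwa [hkc a has, hkc b hbs] at hab
  -- `τ '' t` supports `x` because `τ` fixes `x`. It meets `s` only in `s ∩ t`, where `π` is the
  -- identity, so `σ` fixes all of it.
  have hσx : σ • x = x := by
    refine htx' σ ?_
    intro b hb
    rw [Equiv.Perm.smul_def, hσ b (Or.inr hb)]
    by_cases hbs : b ∈ s
    · rw [hks b hbs]
      refine hπ' b hbs ?_
      obtain ⟨a, ha, rfl⟩ := hb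
      by_cases has : a ∈ s
      · rwa [hτ a (Or.inl has), hfs a has]
      · rw [hτ a (Or.inr ha), hft a has ha] at hbs
        exact (hφs _ hbs).elim
    · exact hkc b hbs
  rw [← smul_eq_smul_of_supports hsx fun a ha => (hσ a (Or.inl ha)).trans (hks a ha), hσx]

end Supports

/-! ## Simulation of automata -/

/-- A relation between the states of two automata that is compatible with start states, transitions
and acceptance forces the languages to agree. -/
theorem DFA.accepts_eq_of_simulation {S P Q : Type*} (M : DFA S P) (N : DFA S Q) (r : P → Q → Prop)
    (hstart : r M.start N.start) (hstep : ∀ p q a, r p q → r (M.step p a) (N.step q a))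
    (haccept : ∀ p q, r p q → (p ∈ M.accept ↔ q ∈ N.accept)) : M.accepts = N.accepts := by
  have key : ∀ (w : List S) p q, r p q → r (M.evalFrom p w) (N.evalFrom q w) := by
    intro w
    induction w with
    | nil => exact fun p q h => h
    | cons a w ih => exact fun p q h => ih _ _ (hstep p q a h)
  ext w
  exact haccept _ _ (key w _ _ hstart)

/-! ## The action on memory configurations -/

section Config

variable {𝔸 Q R : Type*}

theorem RegConfig.perm_one (c : RegConfig 𝔸 Q R) : c.perm 1 = c := by
  simp [RegConfig.perm]

theorem RegConfig.perm_mul (π σ : Equiv.Perm 𝔸) (c : RegConfig 𝔸 Q R) :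
    c.perm (π * σ) = (c.perm σ).perm π := by
  simp [RegConfig.perm, Equiv.Perm.coe_mul]

theorem RegTest.holds_perm (π : Equiv.Perm 𝔸) (c : RegConfig 𝔸 Q R) (a : 𝔸) (t : RegTest Q R) :
    t.Holds (c.perm π) (π a) ↔ t.Holds c a := by
  have hinj := Option.map_injective π.injective
  cases t with
  | eqReg r s => exact hinj.eq_iff
  | eqInput r => exact hinj.eq_iff (b := some a)
  | isEmpty r => exact hinj.eq_iff (b := none)
  | inState q => exact Iff.rfl

theorem RegCondition.holds_perm (π : Equiv.Perm 𝔸) (c : RegConfig 𝔸 Q R) (a : 𝔸)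
    (b : RegCondition Q R) : b.Holds (c.perm π) (π a) ↔ b.Holds c a := by
  cases b with
  | pos t => exact t.holds_perm π c a
  | neg t => exact not_congr (t.holds_perm π c a)

theorem RegAction.apply_perm (π : Equiv.Perm 𝔸) (c : RegConfig 𝔸 Q R) (a : 𝔸)
    (k : RegAction Q R) : k.apply (π a) (c.perm π) = (k.apply a c).perm π := by
  cases k <;> refine Prod.ext rfl (funext fun r => ?_) <;>
    simp only [RegAction.apply, RegConfig.perm, Function.update_apply, Function.comp_apply] <;>
    split_ifs <;> simp

theorem RegAction.foldl_apply_perm (π : Equiv.Perm 𝔸) (a : 𝔸) (l : List (RegAction Q R))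
    (c : RegConfig 𝔸 Q R) :
    l.foldl (RegAction.apply (π a)) (c.perm π) = (l.foldl (RegAction.apply a) c).perm π := by
  induction l generalizing c with
  | nil => rfl
  | cons k l ih => rw [List.foldl_cons, List.foldl_cons, RegAction.apply_perm, ih]

theorem IsSyntacticallyEquivariant.isSemanticallyEquivariant
    {δ : RegConfig 𝔸 Q R → 𝔸 → RegConfig 𝔸 Q R} (h : IsSyntacticallyEquivariant δ) :
    IsSemanticallyEquivariant δ := by
  obtain ⟨P, rfl⟩ := h
  intro π c a
  induction P with
  | nil => rfl
  | cons k P ih =>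
    rw [RegCommand.run, RegCommand.run]
    by_cases h : ∀ b ∈ k.conditions, b.Holds c a
    · rw [if_pos h, if_pos fun b hb => (b.holds_perm π c a).2 (h b hb),
        RegAction.foldl_apply_perm]
    · rw [if_neg h, if_neg fun h' => h fun b hb => (b.holds_perm π c a).1 (h' b hb), ih]

/-- Configurations and inputs that satisfy the same tests differ by a permutation of atoms. -/
theorem exists_perm_of_same_tests [Finite R] {c d : RegConfig 𝔸 Q R} {a b : 𝔸}
    (h : ∀ t : RegTest Q R, t.Holds c a ↔ t.Holds d b) :
    ∃ π : Equiv.Perm 𝔸, c.perm π = d ∧ π a = b := by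
  -- The input is adjoined as an extra entry, at index `none`, so that tests against it become
  -- equalities between entries.
  obtain ⟨π, hπ⟩ := exists_perm_map_eq (ι := Option R) (fun i => i.elim (some a) c.2)
    (fun i => i.elim (some b) d.2)
    (by
      rintro (_ | r) (_ | s)
      · simp
      · simpa [RegTest.Holds, eq_comm] using h (.eqInput s)
      · simpa [RegTest.Holds] using h (.eqInput r)
      · exact h (.eqReg r s))
    (by
      rintro (_ | r)
      · simp
      · exact h (.isEmpty r))
  refine ⟨π, Prod.ext ?_ (funext fun r => hπ (some r)), by simpa using hπ none⟩
  exact ((h (.inState d.1)).2 rfl)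

end Config

/-! ## From register automata to orbit-finite automata -/

theorem isOrbitFiniteSet_atoms (𝔸 : Type*) : IsOrbitFiniteSet 𝔸 𝔸 where
  isSetWithAtoms a := ⟨{a}, Set.finite_singleton a, fun _ hg => hg rfl⟩
  finite_orbits := by
    have : Subsingleton (MulAction.orbitRel.Quotient (Equiv.Perm 𝔸) 𝔸) := by
      classical
      refine ⟨fun x y => ?_⟩
      induction x using Quotient.inductionOn'
      induction y using Quotient.inductionOn'
      exact Quotient.sound' ⟨Equiv.swap _ _, Equiv.swap_apply_right _ _⟩
    infer_instance

section ConfigAction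

variable {𝔸 Q R X : Type*}

/-- The action of atom permutations on a type that is equivalent to memory configurations. -/
abbrev RegConfig.mulAction (e : X ≃ RegConfig 𝔸 Q R) : MulAction (Equiv.Perm 𝔸) X where
  smul π x := e.symm ((e x).perm π)
  one_smul x := by
    change e.symm ((e x).perm 1) = x
    rw [RegConfig.perm_one, e.symm_apply_apply]
  mul_smul π σ x := by
    change e.symm ((e x).perm (π * σ)) = e.symm ((e (e.symm ((e x).perm σ))).perm π)
    rw [RegConfig.perm_mul, e.apply_symm_apply]

theorem RegConfig.isOrbitFiniteSet [Finite Q] [Finite R] (e : X ≃ RegConfig 𝔸 Q R) :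
    letI := RegConfig.mulAction e
    IsOrbitFiniteSet 𝔸 X := by
  let _ := RegConfig.mulAction e
  refine ⟨fun x => ⟨{a | ∃ r, (e x).2 r = some a}, ?_, ?_⟩, ?_⟩
  · refine ((Set.finite_range (e x).2).preimage (Option.some_injective 𝔸).injOn).subset ?_
    rintro a ⟨r, hr⟩
    exact ⟨r, hr⟩
  · intro π hπ
    change e.symm ((e x).perm π) = x
    rw [Equiv.symm_apply_eq]
    refine Prod.ext rfl (funext fun r => ?_)
    change ((e x).2 r).map π = (e x).2 r
    cases hr : (e x).2 r with
    | none => rfl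
    | some a => exact congrArg some (hπ ⟨r, hr⟩)
  -- The pattern takes finitely many values and determines the orbit.
  · let pattern : X → Q × (R → R → Prop) × (R → Prop) := fun x =>
      ((e x).1, fun r s => (e x).2 r = (e x).2 s, fun r => (e x).2 r = none)
    refine Finite.of_injective
      (fun o : MulAction.orbitRel.Quotient (Equiv.Perm 𝔸) X => pattern o.out) fun o p hop => ?_
    have h : ∀ x y : X, pattern x = pattern y → ∃ π : Equiv.Perm 𝔸, π • x = y := by
      intro x y hxy
      simp only [pattern, Prod.mk.injEq] at hxy
      obtain ⟨π, hπ⟩ := exists_perm_map_eq (e x).2 (e y).2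
        (fun r s => iff_of_eq (congrFun (congrFun hxy.2.1 r) s))
        (fun r => iff_of_eq (congrFun hxy.2.2 r))
      refine ⟨π, (Equiv.symm_apply_eq e).2 (Prod.ext hxy.1 (funext hπ))⟩
    obtain ⟨π, hπ⟩ := h _ _ hop
    rw [← Quotient.out_eq o, ← Quotient.out_eq p]
    exact (Quotient.sound (s := MulAction.orbitRel (Equiv.Perm 𝔸) X) ⟨π, hπ⟩).symm

end ConfigAction

theorem IsRegisterRecognizable.isOrbitFiniteRecognizable {𝔸 : Type u} [Countable 𝔸]
    {L : Language 𝔸} (h : IsRegisterRecognizable L) : IsOrbitFiniteRecognizable.{u, v} L := by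
  obtain ⟨Q, R, hQ, hR, A, hA, rfl⟩ := h
  -- There are countably many configurations, so they have a copy in any universe; this is where
  -- countability of the atoms enters.
  let e : Shrink.{v} (RegConfig 𝔸 Q R) ≃ RegConfig 𝔸 Q R := (equivShrink _).symm
  let _ := RegConfig.mulAction e
  have hsmul : ∀ (π : Equiv.Perm 𝔸) x, e (π • x) = (e x).perm π := fun π x =>
    e.apply_symm_apply _
  let B : OrbitFiniteAutomaton 𝔸 𝔸 (Shrink.{v} (RegConfig 𝔸 Q R)) :=
    { step := fun x a => e.symm (A.step (e x) a)
      start := e.symm (A.start, fun _ => none)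
      accept := {x | (e x).1 ∈ A.accept}
      alphabet_orbitFinite := isOrbitFiniteSet_atoms 𝔸
      states_orbitFinite := RegConfig.isOrbitFiniteSet e
      start_equivariant := fun π => e.injective (by
        rw [hsmul, e.apply_symm_apply]; rfl)
      accept_equivariant := fun π x => by
        rw [Set.mem_ofPred_eq, hsmul]; rfl
      step_equivariant := fun π x a => e.injective (by
        rw [hsmul, e.apply_symm_apply, hsmul, e.apply_symm_apply]
        exact hA π (e x) a) }
  refine ⟨_, _, B, DFA.accepts_eq_of_simulation _ _ (fun x c => e x = c)
    (e.apply_symm_apply _) ?_ ?_⟩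
  · rintro x _ a rfl
    exact e.apply_symm_apply _
  · rintro x _ rfl
    exact Iff.rfl

/-! ## Writing programs -/

section Programs

variable {𝔸 Q R : Type*}

instance [Finite Q] [Finite R] : Finite (RegTest Q R) := by
  refine Finite.of_surjective (α := (R × R) ⊕ R ⊕ R ⊕ Q) (fun
    | .inl p => .eqReg p.1 p.2
    | .inr (.inl r) => .eqInput r
    | .inr (.inr (.inl r)) => .isEmpty r
    | .inr (.inr (.inr q)) => .inState q) ?_
  rintro (⟨r, s⟩ | r | r | q)
  · exact ⟨.inl (r, s), rfl⟩
  · exact ⟨.inr (.inl r), rfl⟩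
  · exact ⟨.inr (.inr (.inl r)), rfl⟩
  · exact ⟨.inr (.inr (.inr q)), rfl⟩

/-- There is a program that performs a prescribed list of actions for each set of satisfied
tests. -/
theorem exists_program [Finite Q] [Finite R] (G : Set (RegTest Q R) → List (RegAction Q R)) :
    ∃ P : List (RegCommand Q R), ∀ (c : RegConfig 𝔸 Q R) (a : 𝔸),
      RegCommand.run P c a = (G {t | t.Holds c a}).foldl (RegAction.apply a) c := by
  classical
  have := Fintype.ofFinite (RegTest Q R)
  let cmd : Set (RegTest Q R) → RegCommand Q R := fun τ =>
    -- Every test occurs, positively or negated, so the conditions hold for exactly one set of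
    -- satisfied tests and the order of commands is irrelevant.
    ⟨(Finset.univ : Finset (RegTest Q R)).toList.map fun t => if t ∈ τ then .pos t else .neg t,
      G τ⟩
  have hcmd : ∀ τ (c : RegConfig 𝔸 Q R) (a : 𝔸),
      (∀ b ∈ (cmd τ).conditions, b.Holds c a) ↔ {t | t.Holds c a} = τ := by
    intro τ c a
    simp only [cmd, List.mem_map, Finset.mem_toList, Finset.mem_univ, true_and,
      forall_exists_index, forall_apply_eq_imp_iff, Set.ext_iff, Set.mem_ofPred_eq]
    refine forall_congr' fun t => ?_
    by_cases ht : t ∈ τ <;> simp [ht, RegCondition.Holds]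
  have hrun : ∀ (l : List (Set (RegTest Q R))) (c : RegConfig 𝔸 Q R) (a : 𝔸),
      {t | t.Holds c a} ∈ l →
      RegCommand.run (l.map cmd) c a = (G {t | t.Holds c a}).foldl (RegAction.apply a) c := by
    intro l c a
    induction l with
    | nil => simp
    | cons τ l ih =>
      intro hl
      rw [List.map_cons, RegCommand.run]
      by_cases h : {t | t.Holds c a} = τ
      · rw [if_pos ((hcmd τ c a).2 h), h]
      · rw [if_neg (mt (hcmd τ c a).1 h), ih ((List.mem_cons.1 hl).resolve_left h)]
  exact ⟨(Finset.univ : Finset (Set (RegTest Q R))).toList.map cmd,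
    fun c a => hrun _ c a (by simp)⟩

/-- The registers of a finite set can be overwritten simultaneously by the input, by `⊥` and by
values of registers outside of the set. -/
theorem exists_actions_overwrite (a : 𝔸) (c : RegConfig 𝔸 Q R) (ρ : R → Option 𝔸)
    (F : Finset R) (hF : ∀ r ∉ F, ρ r = c.2 r)
    (hρ : ∀ r ∈ F, ρ r = none ∨ ρ r = some a ∨ ∃ s ∉ F, ρ r = c.2 s) :
    ∃ l : List (RegAction Q R), l.foldl (RegAction.apply a) c = (c.1, ρ) := by
  classical
  induction F using Finset.induction_on generalizing ρ with
  | empty => exact ⟨[], Prod.ext rfl (funext fun r => (hF r (by simp)).symm)⟩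
  | insert r F hr ih =>
    -- Register `r` is written last. Its source lies outside `insert r F`, hence still holds its
    -- original value then.
    obtain ⟨l, hl⟩ := ih (Function.update ρ r (c.2 r))
      (fun s hs => by
        by_cases hsr : s = r
        · rw [hsr, Function.update_self]
        · rw [Function.update_of_ne hsr]
          exact hF s (by simp [hsr, hs]))
      (fun s hs => by
        rw [Function.update_of_ne (ne_of_mem_of_not_mem hs hr)]
        refine (hρ s (Finset.mem_insert_of_mem hs)).imp_right (Or.imp_right ?_)
        exact fun ⟨t, ht, h⟩ => ⟨t, mt Finset.mem_insert_of_mem ht, h⟩)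
    have hk : ∃ k : RegAction Q R,
        k.apply a (c.1, Function.update ρ r (c.2 r)) = (c.1, ρ) := by
      rcases hρ r (Finset.mem_insert_self r F) with h | h | ⟨s, hs, h⟩
      · exact ⟨.clear r, by simp [RegAction.apply, ← h]⟩
      · exact ⟨.load r, by simp [RegAction.apply, ← h]⟩
      · refine ⟨.copy r s, ?_⟩
        have hsr : s ≠ r := fun e => hs (by simp [e])
        simp [RegAction.apply, Function.update_of_ne hsr, hF s hs, ← h]
    obtain ⟨k, hk⟩ := hk
    exact ⟨l ++ [k], by rw [List.foldl_append, hl]; exact hk⟩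

/-- With a second copy of the registers as scratch memory, the control state can be set and all
registers can be assigned simultaneously. -/
theorem exists_actions_assign [Finite R] (a : 𝔸) (c : RegConfig 𝔸 Q (R ⊕ R)) (q : Q)
    (ρ : R → Option 𝔸)
    (hρ : ∀ r, ρ r = none ∨ ρ r = some a ∨ ∃ s, ρ r = c.2 (.inl s)) :
    ∃ l : List (RegAction Q (R ⊕ R)),
      l.foldl (RegAction.apply a) c = (q, Sum.elim ρ ρ) := by
  classical
  have := Fintype.ofFinite R
  -- The new values are first assembled in the scratch copy, while the first copy stays intact as
  -- the source, and are then copied back.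
  obtain ⟨l, hl⟩ := exists_actions_overwrite a c (Sum.elim (fun s => c.2 (.inl s)) ρ)
    (Finset.univ.map Function.Embedding.inr) (by rintro (r | r) hr <;> simp at hr ⊢)
    (by
      rintro (r | r) hr
      · simp at hr
      · refine (hρ r).imp_right (Or.imp_right ?_)
        rintro ⟨s, hs⟩
        exact ⟨.inl s, by simp, hs⟩)
  obtain ⟨m, hm⟩ := exists_actions_overwrite a
    (c.1, (Sum.elim (fun s => c.2 (.inl s)) ρ : R ⊕ R → Option 𝔸)) (Sum.elim ρ ρ)
    (Finset.univ.map Function.Embedding.inl) (by rintro (r | r) hr <;> simp at hr ⊢)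
    (by
      rintro (r | r) hr
      · exact Or.inr (Or.inr ⟨.inr r, by simp, rfl⟩)
      · simp at hr)
  refine ⟨l ++ (m ++ [.setState q]), ?_⟩
  rw [List.foldl_append, hl, List.foldl_append, hm]
  rfl

end Programs

/-! ## From orbit-finite automata to register programs -/

/-- A finite family of orbit representatives with a common finite support. -/
theorem IsOrbitFiniteSet.exists_representatives {𝔸 X : Type*} [MulAction (Equiv.Perm 𝔸) X]
    (h : IsOrbitFiniteSet 𝔸 X) : ∃ (n k : ℕ) (x : Fin n → X) (e : Fin k → 𝔸),
      (∀ y, ∃ (i : Fin n) (g : Equiv.Perm 𝔸), g • x i = y) ∧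
      ∀ i, MulAction.Supports (Equiv.Perm 𝔸) (Set.range e) (x i) := by
  have := h.finite_orbits
  obtain ⟨n, ⟨f⟩⟩ :=
    Finite.exists_equiv_fin (MulAction.orbitRel.Quotient (Equiv.Perm 𝔸) X)
  choose s hs hsupp using h.isSetWithAtoms
  let x : Fin n → X := fun i => (f.symm i).out
  have hfin : (⋃ i, s (x i)).Finite := Set.finite_iUnion fun i => hs _
  have := hfin.to_subtype
  obtain ⟨k, ⟨e⟩⟩ := Finite.exists_equiv_fin (⋃ i, s (x i) : Set 𝔸)
  refine ⟨n, k, x, fun j => e.symm j, fun y => ?_, fun i => ?_⟩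
  · have hy : (x (f (Quotient.mk'' y)) : X) ∈ MulAction.orbit (Equiv.Perm 𝔸) y := by
      rw [← MulAction.orbitRel_apply]
      apply Quotient.exact (s := MulAction.orbitRel (Equiv.Perm 𝔸) X)
      simp only [x, Equiv.symm_apply_apply, Quotient.out_eq]
    obtain ⟨g, hg⟩ := hy
    exact ⟨_, g⁻¹, inv_smul_eq_iff.2 hg.symm⟩
  · refine (hsupp (x i)).mono fun a ha => ?_
    exact ⟨e ⟨a, Set.mem_iUnion.2 ⟨i, ha⟩⟩, by simp⟩

section Represents

variable {𝔸 X I K : Type*} [MulAction (Equiv.Perm 𝔸) X] (x : I → X) (e : K → 𝔸)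

/-- The configuration `c` represents `y`: some permutation `g` takes the representative `x c.1` to
`y`, the nonempty registers of the first copy of `K` hold the `g`-images of the respective atoms
`e s`, and these atoms `e s` support `x c.1`. -/
def Represents (c : RegConfig 𝔸 I (K ⊕ K)) (y : X) : Prop :=
  ∃ g : Equiv.Perm 𝔸, g • x c.1 = y ∧ (∀ s a, c.2 (.inl s) = some a → g (e s) = a) ∧
    MulAction.Supports (Equiv.Perm 𝔸) (e '' {s | c.2 (.inl s) ≠ none}) (x c.1)

variable {x e}

/-- The two witnessing permutations agree on the atoms of the filled registers, which support the
representative. -/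
theorem Represents.unique {c : RegConfig 𝔸 I (K ⊕ K)} {y z : X} (hy : Represents x e c y)
    (hz : Represents x e c z) : y = z := by
  obtain ⟨g, rfl, hg, hs⟩ := hy
  obtain ⟨h, rfl, hh, -⟩ := hz
  refine smul_eq_smul_of_supports hs ?_
  rintro _ ⟨s, hne, rfl⟩
  obtain ⟨a, ha⟩ := Option.ne_none_iff_exists'.1 hne
  rw [hg s a ha, hh s a ha]

theorem Represents.perm {c : RegConfig 𝔸 I (K ⊕ K)} {y : X} (hy : Represents x e c y)
    (π : Equiv.Perm 𝔸) : Represents x e (c.perm π) (π • y) := by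
  obtain ⟨g, rfl, hg, hs⟩ := hy
  refine ⟨π * g, mul_smul _ _ _, fun s a ha => ?_, ?_⟩
  · obtain ⟨b, hb, rfl⟩ := Option.map_eq_some_iff.1 ha
    rw [Equiv.Perm.mul_apply, hg s b hb]
  · simpa [RegConfig.perm] using hs

theorem Represents.supports {c : RegConfig 𝔸 I (K ⊕ K)} {y : X} (hy : Represents x e c y) :
    MulAction.Supports (Equiv.Perm 𝔸) {a | ∃ s, c.2 (.inl s) = some a} y := by
  obtain ⟨g, rfl, hg, hs⟩ := hy
  refine (supports_smul hs g).mono ?_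
  rintro _ ⟨_, ⟨s, hne, rfl⟩, rfl⟩
  obtain ⟨a, ha⟩ := Option.ne_none_iff_exists'.1 hne
  exact ⟨s, by rw [ha, hg s a ha]⟩

/-- An element with a finite support `t` is represented with registers that hold only atoms of
`t`. -/
theorem exists_represents [Infinite 𝔸] [Finite K]
    (hx : ∀ y, ∃ (i : I) (g : Equiv.Perm 𝔸), g • x i = y)
    (he : ∀ i, MulAction.Supports (Equiv.Perm 𝔸) (Set.range e) (x i))
    {t : Set 𝔸} (ht : t.Finite) {y : X} (hty : MulAction.Supports (Equiv.Perm 𝔸) t y) :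
    ∃ (i : I) (ρ : K → Option 𝔸), (∀ s a, ρ s = some a → a ∈ t) ∧
      Represents x e (i, Sum.elim ρ ρ) y := by
  classical
  obtain ⟨i, g, rfl⟩ := hx y
  -- The filled registers are those with `e s` in the `g⁻¹`-image of `t`. This image and the range
  -- of `e` both support `x i`, hence so does their intersection.
  refine ⟨i, fun s => if g (e s) ∈ t then some (g (e s)) else none, ?_, g, rfl, ?_, ?_⟩
  · intro s a h
    dsimp only at h
    split_ifs at h with hs
    cases h
    exact hs
  · intro s a h
    dsimp only [Sum.elim_inl] at h
    split_ifs at h with hs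
    cases h
    rfl
  · have h := supports_smul hty g⁻¹
    rw [inv_smul_smul] at h
    refine (supports_inter (ht.image _) (Set.finite_range e) h (he i)).mono ?_
    rintro _ ⟨⟨a, ha, hae⟩, s, rfl⟩
    refine ⟨s, ?_, rfl⟩
    have : g (e s) = a := by rw [← hae]; exact g.apply_symm_apply a
    simp [this, ha]

/-- For each set of satisfied tests, there is a list of actions that simulates an equivariant
transition. -/
theorem exists_actions_simulate [Infinite 𝔸] [Finite K]
    (hx : ∀ y, ∃ (i : I) (g : Equiv.Perm 𝔸), g • x i = y)
    (he : ∀ i, MulAction.Supports (Equiv.Perm 𝔸) (Set.range e) (x i))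
    {f : X → 𝔸 → X} (hf : ∀ (π : Equiv.Perm 𝔸) y a, f (π • y) (π a) = π • f y a)
    (τ : Set (RegTest I (K ⊕ K))) :
    ∃ l : List (RegAction I (K ⊕ K)), ∀ (c : RegConfig 𝔸 I (K ⊕ K)) (a : 𝔸) (y : X),
      {t | t.Holds c a} = τ → Represents x e c y →
        Represents x e (l.foldl (RegAction.apply a) c) (f y a) := by
  by_cases hτ : ∃ (c : RegConfig 𝔸 I (K ⊕ K)) (a : 𝔸) (y : X),
      {t | t.Holds c a} = τ ∧ Represents x e c y
  swap
  · exact ⟨[], fun c a y h1 h2 => (hτ ⟨c, a, y, h1, h2⟩).elim⟩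
  obtain ⟨c, a, y, rfl, hc⟩ := hτ
  have hfin : (insert a {b | ∃ s, c.2 (.inl s) = some b}).Finite := by
    refine Set.Finite.insert a
      (((Set.finite_range c.2).preimage (Option.some_injective 𝔸).injOn).subset ?_)
    rintro b ⟨s, hs⟩
    exact ⟨.inl s, hs⟩
  have hsupp : MulAction.Supports (Equiv.Perm 𝔸) (insert a {b | ∃ s, c.2 (.inl s) = some b})
      (f y a) := by
    intro π hπ
    have h1 : π • y = y := hc.supports π fun b hb => hπ (Or.inr hb)
    have h2 : π a = a := hπ (Or.inl rfl)
    rw [← hf, h1, h2]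
  obtain ⟨i, ρ, hρ, hrep⟩ := exists_represents hx he hfin hsupp
  obtain ⟨l, hl⟩ := exists_actions_assign a c i ρ fun s => by
    cases hs : ρ s with
    | none => exact Or.inl rfl
    | some b =>
      rcases hρ s b hs with rfl | ⟨r, hr⟩
      · exact Or.inr (Or.inl rfl)
      · exact Or.inr (Or.inr ⟨r, hr.symm⟩)
  -- The list found for one triple serves every other: equal tests give a `π`-translate of `c` and
  -- `a`, uniqueness forces `z = π • y`, and both the actions and `f` commute with `π`.
  refine ⟨l, fun d b z hd hz => ?_⟩
  obtain ⟨π, rfl, rfl⟩ := exists_perm_of_same_tests fun t => (Set.ext_iff.1 hd t).symm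
  rw [hz.unique (hc.perm π), hf, RegAction.foldl_apply_perm, hl]
  exact hrep.perm π

end Represents

theorem IsOrbitFiniteRecognizable.isRegisterProgramRecognizable {𝔸 : Type u} [Infinite 𝔸]
    {L : Language 𝔸} (h : IsOrbitFiniteRecognizable.{u, v} L) :
    IsRegisterProgramRecognizable L := by
  obtain ⟨X, _, B, rfl⟩ := h
  obtain ⟨n, k, x, e, hx, he⟩ := B.states_orbitFinite.exists_representatives
  choose G hG using exists_actions_simulate hx he (f := B.step) B.step_equivariant
  obtain ⟨P, hP⟩ := exists_program (𝔸 := 𝔸) G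
  obtain ⟨i, g, hi⟩ := hx B.start
  have hxi : x i = B.start := by rw [← inv_smul_smul g (x i), hi, B.start_equivariant]
  refine ⟨Fin n, Fin k ⊕ Fin k, inferInstance, inferInstance,
    ⟨i, {j | x j ∈ B.accept}, RegCommand.run P⟩, ⟨P, rfl⟩,
    DFA.accepts_eq_of_simulation _ _ (Represents x e) ?_ ?_ ?_⟩
  -- With all registers empty, the empty set must support `x i`; it does, since `x i` is the
  -- invariant start state.
  · refine ⟨g, hi, fun s a hs => absurd hs (Option.some_ne_none a).symm, fun π _ => ?_⟩
    change π • x i = x i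
    rw [hxi, B.start_equivariant]
  · intro c y a hc
    change Represents x e (RegCommand.run P c a) _
    rw [hP]
    exact hG _ c a y rfl hc
  · rintro c _ ⟨g, rfl, -, -⟩
    exact (B.accept_equivariant g (x c.1)).symm

theorem IsRegisterProgramRecognizable.isRegisterRecognizable {𝔸 : Type u} {L : Language 𝔸}
    (h : IsRegisterProgramRecognizable L) : IsRegisterRecognizable L := by
  obtain ⟨Q, R, hQ, hR, A, hA, hL⟩ := h
  exact ⟨Q, R, hQ, hR, A, hA.isSemanticallyEquivariant, hL⟩

theorem mainTheorem12 {𝔸 : Type u} [Countable 𝔸] [Infinite 𝔸] (L : Language 𝔸) :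
    (IsRegisterRecognizable L ↔ IsOrbitFiniteRecognizable.{u, v} L) ∧
      (IsRegisterProgramRecognizable L ↔ IsOrbitFiniteRecognizable.{u, v} L) :=
  ⟨⟨fun h => h.isOrbitFiniteRecognizable,
      fun h => h.isRegisterProgramRecognizable.isRegisterRecognizable⟩,
    ⟨fun h => h.isRegisterRecognizable.isOrbitFiniteRecognizable,
      fun h => h.isRegisterProgramRecognizable⟩⟩
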